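/- **Notions.** An *Archimedean generator* is a continuous, non-increasing function $\psi:[0,\infty]\to[0,1]$ with $\psi(0)=1$, $\psi(\infty)=0$ that is strictly decreasing on $[0,\inf\{t:\psi(t)=0\}]$; put $\psi^-(s)=\inf\{t:\psi(t)=s\}$. A function $f$ is *completely monotone* (c.m.) if it is smooth on $(0,\infty)$ and $(-1)^n f^{(n)}(t)\ge 0$ for all $n\ge 0$, $t>0$. Let $\widetilde\Psi^2$ be the set of pairs $(\psi_1,\psi_2)$ of c.m. generators such that $(\psi_1^-\circ\psi_2)'$ is c.m. For a generator $\psi$ let $C_\psi(u_1,\dots,u_n)=\psi(\psi^-(u_1)+\dots+\psi^-(u_n))$, and for a bivariate copula $C$ let $\tau(C)=4\int_{[0,1]^2} C\,dC-1$. A *family* $a$ consists of a parameter range $\Theta_a\subseteq\mathbb R$ and of c.m. generators $\psi^{(a,\theta)}$, $\theta\in\Theta_a$. **Hierarchical functions.** Consider a rooted tree with leaves $1,\dots,d$ and forks $d+1,\dots,d+k$, rooted in $d+k$, in which every fork has at least two children, and let $\lambda$ label the forks with c.m. generators. For $u\in[0,1]^d$ put $x_v=u_v$ at every leaf $v$,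 and, at every fork $v$, let $x_v$ be the value of $C_{\lambda(v)}$ at the values $x_w$ of the children $w$ of $v$. Then $C_{(V,E,\lambda)}(u)=x_{d+k}$ defines a function $C_{(V,E,\lambda)}:[0,1]^d\to[0,1]$. **Algorithm 1 (structure).** Input: a symmetric real matrix $(\tau_{ij})_{1\le i,j\le d}$, $d\ge 2$ (for example, a sample Kendall correlation matrix). Start with $\mathcal I=\{1,\dots,d\}$ and $\downarrow(i)=\{i\}$ for $i\le d$. For $k=1,\dots,d-1$: choose $i<j$ in $\mathcal I$ that maximize the average of the $\tau_{pq}$ over $(p,q)\in\downarrow(i)\times\downarrow(j)$ (ties are broken arbitrarily); make $i,j$ the children of a new fork $d+k$; put $\downarrow(d+k)=\downarrow(i)\cup\downarrow(j)$; let $\hat\tau_{d+k}$ be that maximal average; and replace $\mathcal I$ by $(\mathcal I\cup\{d+k\})\setminus\{i,j\}$. Output: the tree $(\hat V,\hat E)$ and $(\hat\tau_v)_{v=d+1}^{2d-1}$. **Algorithm 2 (homogeneous estimation).** For every fork $v$ of $(\hat V,\hat E)$ put $\hat\theta_v=\tau_{(a)}^{-1}(\hat\tau_v)$, where $\tau_{(a)}^{-1}$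 is the inverse of $\tau_{(a)}$ on $\Theta_a$, and $\hat\lambda(v)=\psi^{(a,\hat\theta_v)}$. Output: $(\hat V,\hat E,\hat\lambda)$. **Theorem.** Let $a$ be a family and $\tau_{(a)}$ a real function such that 1. $\tau_{(a)}(\theta)=\tau(C_{\psi^{(a,\theta)}})$, with the bivariate copula $C_{\psi^{(a,\theta)}}$, for all $\theta\in\Theta_a$; 2. $\tau_{(a)}$ is strictly increasing on $\Theta_a$; 3. for all $\theta_1,\theta_2\in\Theta_a$: $(\psi^{(a,\theta_1)},\psi^{(a,\theta_2)})\in\widetilde\Psi^2$ if and only if $\theta_1\le\theta_2$. Let $(\hat V,\hat E,(\hat\tau_v)_{v=d+1}^{2d-1})$ be any output of Algorithm 1. If $\hat\tau_v\in\tau_{(a)}(\Theta_a)$ for all $v\in\{d+1,\dots,2d-1\}$, then the output $(\hat V,\hat E,\hat\lambda)$ of Algorithm 2 satisfies $\hat\theta_v\le\hat\theta_w$ for every fork $v$ and every child $w$ of $v$ that is a fork, and the function $C_{(\hat V,\hat E,\hat\lambda)}$ is well defined and is a $d$-copula. -/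

import Mathlib

open Set MeasureTheory
open scoped ENNReal ContDiff

/-! Archimedean generators -/

/-- An Archimedean generator `ψ : [0, ∞] → [0, 1]`. -/
structure IsGenerator (ψ : ℝ≥0∞ → ℝ) : Prop where
  mem_unit : ∀ t, ψ t ∈ Icc (0 : ℝ) 1
  continuous : Continuous ψ
  antitone : Antitone ψ
  map_zero : ψ 0 = 1
  map_top : ψ ⊤ = 0
  strictAntiOn : StrictAntiOn ψ (Icc 0 (sInf {t | ψ t = 0}))

/-- Complete monotonicity on `(0, ∞)`: `f` is smooth there and `(-1)^n f^(n) ≥ 0` for all `n`. -/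
def IsCompletelyMonotone (f : ℝ → ℝ) : Prop :=
  ContDiffOn ℝ ∞ f (Ioi 0) ∧ ∀ n : ℕ, ∀ t : ℝ, 0 < t → 0 ≤ (-1 : ℝ) ^ n * iteratedDeriv n f t

/-- A completely monotone Archimedean generator. -/
def IsCMGenerator (ψ : ℝ≥0∞ → ℝ) : Prop :=
  IsGenerator ψ ∧ IsCompletelyMonotone (fun t : ℝ => ψ (ENNReal.ofReal t))

/-- The generalized inverse `ψ⁻(s) = inf {t | ψ t = s}`, with values in `[0, ∞]`. -/
noncomputable def genInv (ψ : ℝ≥0∞ → ℝ) (s : ℝ) : ℝ≥0∞ := sInf {t | ψ t = s}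

/-- `ψ (∑ i ∈ s, ψ⁻(x i))`: the Archimedean copula of `ψ` at the coordinates of `x` indexed
by `s`. -/
noncomputable def archValue {ι : Type*} (ψ : ℝ≥0∞ → ℝ) (s : Finset ι) (x : ι → ℝ) : ℝ :=
  ψ (∑ i ∈ s, genInv ψ (x i))

/-- The `n`-dimensional Archimedean copula `C_ψ`. -/
noncomputable def archCopula (n : ℕ) (ψ : ℝ≥0∞ → ℝ) (u : Fin n → ℝ) : ℝ :=
  archValue ψ Finset.univ u

/-- The sufficient nesting condition for a parent generator `ψ₁` and a child generator `ψ₂`: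
both are completely monotone and `(ψ₁⁻¹ ∘ ψ₂)'` is completely monotone. -/
def SufficientNesting (ψ₁ ψ₂ : ℝ≥0∞ → ℝ) : Prop :=
  IsCMGenerator ψ₁ ∧ IsCMGenerator ψ₂ ∧
    DifferentiableOn ℝ (fun t : ℝ => (genInv ψ₁ (ψ₂ (ENNReal.ofReal t))).toReal) (Ioi 0) ∧
    IsCompletelyMonotone (deriv fun t : ℝ => (genInv ψ₁ (ψ₂ (ENNReal.ofReal t))).toReal)

/-- A one-parameter family of completely monotone Archimedean generators with parameter
range `Θ ⊆ ℝ`. -/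
structure ArchFamily where
  Θ : Set ℝ
  gen : ℝ → ℝ≥0∞ → ℝ
  isCMGenerator : ∀ θ ∈ Θ, IsCMGenerator (gen θ)

/-! Copulas and Kendall's tau -/

/-- `C` (its restriction to `[0,1]^n`) is an `n`-copula: it is grounded, has uniform margins, and
gives every box a nonnegative volume. -/
structure IsCopula {n : ℕ} (C : (Fin n → ℝ) → ℝ) : Prop where
  grounded : ∀ u ∈ Icc (0 : Fin n → ℝ) 1, (∃ i, u i = 0) → C u = 0
  margins : ∀ u ∈ Icc (0 : Fin n → ℝ) 1, ∀ i, (∀ j, j ≠ i → u j = 1) → C u = u i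
  increasing : ∀ a ∈ Icc (0 : Fin n → ℝ) 1, ∀ b ∈ Icc (0 : Fin n → ℝ) 1, a ≤ b →
    0 ≤ ∑ S : Finset (Fin n), (-1 : ℝ) ^ S.card * C (fun i => if i ∈ S then a i else b i)

open Classical in
/-- The probability measure whose distribution function on `[0,1]^n` is `C`; it is unique, and
it exists for every copula `C`. -/
noncomputable def copulaMeasure {n : ℕ} (C : (Fin n → ℝ) → ℝ) : Measure (Fin n → ℝ) :=
  if h : ∃ μ : Measure (Fin n → ℝ), IsProbabilityMeasure μ ∧
      ∀ u ∈ Icc (0 : Fin n → ℝ) 1, μ (Iic u) = ENNReal.ofReal (C u)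
  then h.choose else 0

/-- Kendall's tau of a bivariate copula, `4 ∫ C dC - 1`. -/
noncomputable def kendallTau (C : (Fin 2 → ℝ) → ℝ) : ℝ :=
  4 * (∫ u in Icc (0 : Fin 2 → ℝ) 1, C u ∂(copulaMeasure C)) - 1

/-! Hierarchical Archimedean copulas. Nodes are numbered from `0`: with `d` leaves and `k` forks,
the leaves are `0, …, d - 1`, the forks are `d, …, d + k - 1`, and the root is `d + k - 1`.
A rooted tree is given by the map `children` that sends a node to the set of its children. -/

/-- `children` describes a rooted tree with leaves `0, …, d - 1`, forks `d, …, d + k - 1`, and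
root `d + k - 1`, in which every fork has at least two children. -/
structure IsHACStructure (d k : ℕ) (children : ℕ → Finset ℕ) : Prop where
  child_lt : ∀ v < d + k, ∀ w ∈ children v, w < d + k
  leaf : ∀ v < d, children v = ∅
  fork : ∀ v, d ≤ v → v < d + k → 2 ≤ (children v).card
  root : ∀ v < d + k, d + k - 1 ∉ children v
  parent : ∀ w < d + k - 1, ∃! v, v < d + k ∧ w ∈ children v
  reachable : ∀ w < d + k, Relation.ReflTransGen (fun v v' => v' ∈ children v) (d + k - 1) w

/-- `x` is the vector of node values belonging to the argument `u`: a leaf carries its coordinate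
of `u`, and a fork carries the Archimedean copula of its label at the values of its children. -/
structure IsNodeValues (d k : ℕ) (children : ℕ → Finset ℕ) (lab : ℕ → ℝ≥0∞ → ℝ)
    (u : Fin d → ℝ) (x : ℕ → ℝ) : Prop where
  mem_unit : ∀ v < d + k, x v ∈ Icc (0 : ℝ) 1
  fork : ∀ v, d ≤ v → v < d + k → x v = archValue (lab v) (children v) x
  leaf : ∀ i : Fin d, x i = u i

/-- `C` is the function `C_(V, E, lab)` on `[0,1]^d`: the structure is a tree, the forks are labeled
with completely monotone generators, node values exist for every argument, and the value of `C`
is the value at the root. -/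
structure IsHACFunction (d k : ℕ) (children : ℕ → Finset ℕ) (lab : ℕ → ℝ≥0∞ → ℝ)
    (C : (Fin d → ℝ) → ℝ) : Prop where
  tree : IsHACStructure d k children
  label : ∀ v, d ≤ v → v < d + k → IsCMGenerator (lab v)
  exists_values : ∀ u ∈ Icc (0 : Fin d → ℝ) 1, ∃ x, IsNodeValues d k children lab u x
  eq_root : ∀ u ∈ Icc (0 : Fin d → ℝ) 1, ∀ x, IsNodeValues d k children lab u x →
    C u = x (d + k - 1)

/-! Structure estimation -/

/-- The average of the entries `T i j` over `(i, j) ∈ A × B`. -/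
noncomputable def blockAvg {d : ℕ} (T : Matrix (Fin d) (Fin d) ℝ) (A B : Finset (Fin d)) : ℝ :=
  (∑ p ∈ A ×ˢ B, T p.1 p.2) / ((A ×ˢ B).card : ℝ)

/-- The variables of the structure estimation algorithm. -/
structure ClusterState (d : ℕ) where
  /-- the nodes that are still to be joined -/
  active : Finset ℕ
  /-- the children of a node -/
  children : ℕ → Finset ℕ
  /-- the descendant leaves of a node -/
  leaves : ℕ → Finset (Fin d)
  /-- the estimate of Kendall's tau at a fork -/
  tauHat : ℕ → ℝ

/-- The initial state: every leaf is active, and there are no edges. -/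
def ClusterState.init (d : ℕ) : ClusterState d where
  active := Finset.range d
  children := fun _ => ∅
  leaves := fun v => Finset.univ.filter fun l : Fin d => (l : ℕ) = v
  tauHat := fun _ => 0

/-- Join the nodes `i` and `j` to the new fork `f`. -/
noncomputable def ClusterState.join {d : ℕ} (T : Matrix (Fin d) (Fin d) ℝ) (s : ClusterState d)
    (i j f : ℕ) : ClusterState d where
  active := insert f s.active \ {i, j}
  children := Function.update s.children f {i, j}
  leaves := Function.update s.leaves f (s.leaves i ∪ s.leaves j)
  tauHat := Function.update s.tauHat f (blockAvg T (s.leaves i) (s.leaves j))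

/-- `(i, j)` maximizes the average similarity among the pairs of active nodes `i < j`. -/
def ClusterState.IsArgmax {d : ℕ} (T : Matrix (Fin d) (Fin d) ℝ) (s : ClusterState d)
    (i j : ℕ) : Prop :=
  i ∈ s.active ∧ j ∈ s.active ∧ i < j ∧
    ∀ i' ∈ s.active, ∀ j' ∈ s.active, i' < j' →
      blockAvg T (s.leaves i') (s.leaves j') ≤ blockAvg T (s.leaves i) (s.leaves j)

/-- `StructureRun T k s`: the algorithm with input `T` can be in state `s` after `k` passes of its
loop. Ties in the argmax may be broken in any way. The pass after `k` passes creates the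
fork `d + k`. -/
inductive StructureRun {d : ℕ} (T : Matrix (Fin d) (Fin d) ℝ) : ℕ → ClusterState d → Prop
  | init : StructureRun T 0 (ClusterState.init d)
  | step (k : ℕ) (s : ClusterState d) (i j : ℕ) (hs : StructureRun T k s)
      (hij : s.IsArgmax T i j) : StructureRun T (k + 1) (s.join T i j (d + k))

/-- `s` holds an output of the structure estimation algorithm: `d - 1` passes have been made. -/
def IsStructureEstimate {d : ℕ} (T : Matrix (Fin d) (Fin d) ℝ) (s : ClusterState d) : Prop :=
  StructureRun T (d - 1) s

/-! Homogeneous estimation -/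

/-- The estimated parameter `τ_a⁻¹(τ̂_v)`, where `τ_a⁻¹` is the inverse of `τ_a` on the parameter
range. -/
noncomputable def thetaHat (F : ArchFamily) (τa : ℝ → ℝ) (tauHat : ℕ → ℝ) (v : ℕ) : ℝ :=
  Function.invFunOn τa F.Θ (tauHat v)

/-- The estimated labeling: the generator of the family with the estimated parameter. -/
noncomputable def labelHat (F : ArchFamily) (τa : ℝ → ℝ) (tauHat : ℕ → ℝ) (v : ℕ) :
    ℝ≥0∞ → ℝ :=
  F.gen (thetaHat F τa tauHat v)

/-! Two independent facts carry the theorem.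

The estimated parameters are ordered. The average over a merged cluster is a weighted mean of the
averages over its two parts (`blockAvg_union_le`), so joining a maximizing pair never creates a
larger average. Hence `tauHat` does not increase in the order of creation of the forks. A child fork
is created before its parent, and `τa` is strictly increasing, so parameters do not decrease from
parent to child, and the family gives the nesting condition on every edge between forks.

Nesting yields a copula. The volume of a box is an alternating sum, over subsets `S` of the
coordinates, of the values at its vertices. For a box in `(0,1]^d`, the value at a fork `v` is `lab
v` applied to a completely alternating function of `S` (`exists_isAlternating`): leaves contribute
two-valued alternating functions, sums preserve alternation, and so does passing from a child fork
to its parent through `ψ₁⁻ ∘ ψ₂`, whose derivative is completely monotone. At the root, a completely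
monotone function of a nonnegative alternating function has nonnegative alternating sums.

Both composition facts rest on `altSum_comp_nonpos_of_deriv`, an interpolation argument that
replaces the representation of completely monotone functions as Laplace transforms. -/

/-! Alternating sums of set functions -/

/-- The alternating sum of `F (S ∪ R)` over the subsets `S` of `A`. -/
def altSum {ι : Type*} [DecidableEq ι] (A R : Finset ι) (F : Finset ι → ℝ) : ℝ :=
  ∑ S ∈ A.powerset, (-1 : ℝ) ^ S.card * F (S ∪ R)

/-- A completely alternating set function (no condition is put on its values). -/
def IsAlternating {ι : Type*} [DecidableEq ι] (g : Finset ι → ℝ) : Prop :=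
  ∀ A R : Finset ι, A.Nonempty → altSum A R g ≤ 0

section AltSum

variable {ι : Type*} [DecidableEq ι]

theorem altSum_empty (R : Finset ι) (F : Finset ι → ℝ) : altSum ∅ R F = F R := by
  simp [altSum]

theorem altSum_add (A R : Finset ι) (F G : Finset ι → ℝ) :
    altSum A R (fun S => F S + G S) = altSum A R F + altSum A R G := by
  simp [altSum, mul_add, Finset.sum_add_distrib]

theorem altSum_sub (A R : Finset ι) (F G : Finset ι → ℝ) :
    altSum A R (fun S => F S - G S) = altSum A R F - altSum A R G := by
  simp [altSum, mul_sub, Finset.sum_sub_distrib]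

theorem altSum_neg (A R : Finset ι) (F : Finset ι → ℝ) :
    altSum A R (fun S => -F S) = -altSum A R F := by
  simp [altSum]

theorem altSum_const_mul (A R : Finset ι) (c : ℝ) (F : Finset ι → ℝ) :
    altSum A R (fun S => c * F S) = c * altSum A R F := by
  simp only [altSum, Finset.mul_sum]
  exact Finset.sum_congr rfl fun S _ => by ring

theorem altSum_sum {κ : Type*} (s : Finset κ) (A R : Finset ι) (F : κ → Finset ι → ℝ) :
    altSum A R (fun S => ∑ w ∈ s, F w S) = ∑ w ∈ s, altSum A R (F w) := by
  simp only [altSum, Finset.mul_sum]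
  exact Finset.sum_comm

theorem altSum_comp_insert (i : ι) (A R : Finset ι) (F : Finset ι → ℝ) :
    altSum A R (fun S => F (insert i S)) = altSum A (insert i R) F := by
  simp [altSum, Finset.union_insert]

theorem altSum_insert {i : ι} {A : Finset ι} (hi : i ∉ A) (R : Finset ι) (F : Finset ι → ℝ) :
    altSum (insert i A) R F = altSum A R F - altSum A (insert i R) F := by
  rw [altSum, Finset.sum_powerset_insert hi, altSum, altSum, sub_eq_add_neg,
    ← Finset.sum_neg_distrib]
  congr 1
  refine Finset.sum_congr rfl fun S hS => ?_
  have : i ∉ S := fun h => hi (Finset.mem_powerset.1 hS h)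
  rw [Finset.card_insert_of_notMem this, Finset.insert_union, Finset.union_insert, pow_succ]
  ring

theorem altSum_insert' {i : ι} {A : Finset ι} (hi : i ∉ A) (R : Finset ι) (F : Finset ι → ℝ) :
    altSum (insert i A) R F = altSum A R (fun S => F S - F (insert i S)) := by
  rw [altSum_insert hi, altSum_sub, altSum_comp_insert]

/-- A discrete Leibniz rule: the difference of `F * G` in direction `i` is `ΔF * G + F(insert i ·) *
ΔG`, and both products satisfy the hypotheses on the smaller set. -/
theorem altSum_mul_nonneg (A : Finset ι) :
    ∀ F G : Finset ι → ℝ, (∀ B ⊆ A, ∀ R, 0 ≤ altSum B R F) → (∀ B ⊆ A, ∀ R, 0 ≤ altSum B R G) →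
      ∀ R, 0 ≤ altSum A R (fun S => F S * G S) := by
  induction A using Finset.induction_on with
  | empty =>
    intro F G hF hG R
    have h1 := hF ∅ subset_rfl R
    have h2 := hG ∅ subset_rfl R
    rw [altSum_empty] at *
    exact mul_nonneg h1 h2
  | insert i A hi ih =>
    intro F G hF hG R
    have hdiff : ∀ H : Finset ι → ℝ, (∀ B ⊆ insert i A, ∀ R, 0 ≤ altSum B R H) →
        ∀ B ⊆ A, ∀ R, 0 ≤ altSum B R (fun S => H S - H (insert i S)) := fun H hH B hB R => by
      rw [← altSum_insert' fun h => hi (hB h)]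
      exact hH _ (Finset.insert_subset_insert i hB) R
    have hsplit : (fun S => F S * G S - F (insert i S) * G (insert i S)) = fun S =>
        (F S - F (insert i S)) * G S + F (insert i S) * (G S - G (insert i S)) := by
      funext S; ring
    rw [altSum_insert' hi, hsplit, altSum_add]
    refine add_nonneg (ih _ _ (hdiff F hF) (fun B hB => hG B (hB.trans (Finset.subset_insert i A))) R)
      (ih _ _ (fun B hB R => ?_) (hdiff G hG) R)
    rw [altSum_comp_insert]
    exact hF B (hB.trans (Finset.subset_insert i A)) _

/-! ### Stability of complete alternation -/

namespace IsAlternating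

theorem add {g k : Finset ι → ℝ} (hg : IsAlternating g) (hk : IsAlternating k) :
    IsAlternating (fun S => g S + k S) := fun A R hA => by
  rw [altSum_add]
  exact add_nonpos (hg A R hA) (hk A R hA)

theorem const_mul {g : Finset ι → ℝ} (hg : IsAlternating g) {c : ℝ} (hc : 0 ≤ c) :
    IsAlternating (fun S => c * g S) := fun A R hA => by
  rw [altSum_const_mul]
  exact mul_nonpos_of_nonneg_of_nonpos hc (hg A R hA)

theorem sum {κ : Type*} {s : Finset κ} {g : κ → Finset ι → ℝ}
    (hg : ∀ w ∈ s, IsAlternating (g w)) : IsAlternating (fun S => ∑ w ∈ s, g w S) :=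
  fun A R hA => by
    rw [altSum_sum]
    exact Finset.sum_nonpos fun w hw => hg w hw A R hA

theorem comp_insert {g : Finset ι → ℝ} (hg : IsAlternating g) (i : ι) :
    IsAlternating (fun S => g (insert i S)) := fun A R hA => by
  rw [altSum_comp_insert]
  exact hg A _ hA

theorem const (c : ℝ) : IsAlternating (fun _ : Finset ι => c) := fun A R hA => by
  obtain ⟨i, hi⟩ := hA
  rw [← Finset.insert_erase hi, altSum_insert (Finset.notMem_erase i A)]
  simp [altSum]

/-- Differencing in any direction other than `i` gives zero, so only `A = {i}` matters. This is the
contribution of a leaf. -/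
theorem ite_mem (i : ι) {p q : ℝ} (h : q ≤ p) :
    IsAlternating (fun S : Finset ι => if i ∈ S then p else q) := fun A R hA => by
  by_cases hAi : A = {i}
  · subst hAi
    rw [← insert_empty_eq, altSum_insert (Finset.notMem_empty i), altSum_empty, altSum_empty]
    by_cases hR : i ∈ R <;> simp [hR, h]
  · obtain ⟨j, hj, hji⟩ : ∃ j ∈ A, j ≠ i := by
      by_contra! hcon
      exact hAi (Finset.eq_singleton_iff_nonempty_unique_mem.2 ⟨hA, hcon⟩)
    rw [← Finset.insert_erase hj, altSum_insert' (Finset.notMem_erase j A)]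
    simp [altSum, hji.symm]

theorem altSum_sub_nonneg {g : Finset ι → ℝ} (hg : IsAlternating g) {i : ι} {A : Finset ι}
    (hi : i ∉ A) (R : Finset ι) : 0 ≤ altSum A R (fun S => g (insert i S) - g S) := by
  have h := hg (insert i A) R (Finset.insert_nonempty i A)
  rw [altSum_insert hi] at h
  rw [altSum_sub, altSum_comp_insert]
  linarith

/-- Move `g` linearly to `g (insert i ·)`. The path stays positive and alternating, and the
derivative of the alternating sum along it is that of `f' ∘ γ` times the increment of `g`. Both
factors have nonnegative alternating sums over subsets of `A`, so the product does too. One element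
of the index set is traded for one derivative of `f`. -/
theorem altSum_comp_nonpos_of_deriv {f f' : ℝ → ℝ} (hf : ∀ t, 0 < t → HasDerivAt f (f' t) t)
    {i : ι} {A : Finset ι} (hi : i ∉ A)
    (hf' : ∀ g : Finset ι → ℝ, (∀ S, 0 < g S) → IsAlternating g →
      ∀ B ⊆ A, ∀ R, 0 ≤ altSum B R (fun S => f' (g S)))
    {g : Finset ι → ℝ} (hpos : ∀ S, 0 < g S) (hg : IsAlternating g) (R : Finset ι) :
    altSum (insert i A) R (fun S => f (g S)) ≤ 0 := by
  set γ : ℝ → Finset ι → ℝ := fun t S => g S + t * (g (insert i S) - g S) with hγ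
  have hγ_eq : ∀ t, γ t = fun S => (1 - t) * g S + t * g (insert i S) := fun t => by
    funext S; simp only [hγ]; ring
  have hγ_pos : ∀ t ∈ Icc (0 : ℝ) 1, ∀ S, 0 < γ t S := fun t ht S => by
    rw [hγ_eq]
    rcases ht.1.eq_or_lt with h0 | h0
    · simp [← h0, hpos]
    · have h1 := mul_nonneg (sub_nonneg.2 ht.2) (hpos S).le
      have h2 := mul_pos h0 (hpos (insert i S))
      simp only
      linarith
  have hγ_alt : ∀ t ∈ Icc (0 : ℝ) 1, IsAlternating (γ t) := fun t ht => by
    rw [hγ_eq]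
    exact (hg.const_mul (sub_nonneg.2 ht.2)).add ((hg.comp_insert i).const_mul ht.1)
  have hder : ∀ t ∈ Icc (0 : ℝ) 1, HasDerivAt (fun t => altSum A R (fun S => f (γ t S)))
      (altSum A R (fun S => f' (γ t S) * (g (insert i S) - g S))) t := fun t ht => by
    unfold altSum
    refine HasDerivAt.fun_sum fun S _ => HasDerivAt.const_mul _ ?_
    refine (hf _ (hγ_pos t ht _)).comp t ?_
    simpa [hγ] using ((hasDerivAt_id t).mul_const
      (g (insert i (S ∪ R)) - g (S ∪ R))).const_add (g (S ∪ R))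
  have hmono : MonotoneOn (fun t => altSum A R (fun S => f (γ t S))) (Icc 0 1) := by
    refine monotoneOn_of_deriv_nonneg (convex_Icc 0 1)
      (fun t ht => (hder t ht).continuousAt.continuousWithinAt)
      (fun t ht => (hder t (interior_subset ht)).differentiableAt.differentiableWithinAt)
      fun t ht => ?_
    have ht := interior_subset ht
    rw [(hder t ht).deriv]
    exact altSum_mul_nonneg A _ _ (hf' _ (hγ_pos t ht) (hγ_alt t ht))
      (fun B hB R => hg.altSum_sub_nonneg (fun h => hi (hB h)) R) R
  have h01 := hmono (left_mem_Icc.2 zero_le_one) (right_mem_Icc.2 zero_le_one) zero_le_one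
  simp only [hγ, zero_mul, add_zero, one_mul, add_sub_cancel] at h01
  rw [altSum_insert' hi, altSum_sub]
  linarith

theorem tendsto_altSum_comp_add {f : ℝ → ℝ} (hf : ContinuousOn f (Ici 0)) {g : Finset ι → ℝ}
    (hg : ∀ S, 0 ≤ g S) (A R : Finset ι) :
    Filter.Tendsto (fun ε : ℝ => altSum A R (fun S => f (g S + ε))) (nhdsWithin 0 (Ioi 0))
      (nhds (altSum A R (fun S => f (g S)))) := by
  unfold altSum
  refine tendsto_finsetSum _ fun S _ => Filter.Tendsto.const_mul _ ?_
  refine (hf (g (S ∪ R)) (hg _)).tendsto.comp (tendsto_nhdsWithin_iff.2 ⟨?_, ?_⟩)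
  · refine Filter.Tendsto.mono_left ?_ nhdsWithin_le_nhds
    exact Continuous.tendsto' (by fun_prop) _ _ (by simp)
  · filter_upwards [self_mem_nhdsWithin] with ε hε
    exact add_nonneg (hg _) (le_of_lt hε)

end IsAlternating

/-! ### Completely monotone functions of alternating set functions -/

namespace IsCompletelyMonotone

theorem hasDerivAt {f : ℝ → ℝ} (hf : IsCompletelyMonotone f) {t : ℝ} (ht : 0 < t) :
    HasDerivAt f (deriv f t) t :=
  ((hf.1.differentiableOn (by simp) t ht).differentiableAt (Ioi_mem_nhds ht)).hasDerivAt

theorem neg_deriv {f : ℝ → ℝ} (hf : IsCompletelyMonotone f) :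
    IsCompletelyMonotone (fun t => -deriv f t) := by
  refine ⟨((contDiffOn_infty_iff_deriv_of_isOpen isOpen_Ioi).1 hf.1).2.neg, fun n t ht => ?_⟩
  have h := hf.2 (n + 1) t ht
  rw [iteratedDeriv_succ', pow_succ] at h
  rw [iteratedDeriv_fun_neg]
  linarith

theorem altSum_comp_nonneg_of_pos (A : Finset ι) : ∀ {f : ℝ → ℝ}, IsCompletelyMonotone f →
    ∀ {g : Finset ι → ℝ}, (∀ S, 0 < g S) → IsAlternating g →
      ∀ R, 0 ≤ altSum A R (fun S => f (g S)) := by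
  induction A using Finset.strongInduction with
  | H A ih =>
    intro f hf g hpos hg R
    rcases A.eq_empty_or_nonempty with rfl | ⟨i, hi⟩
    · rw [altSum_empty]
      simpa using hf.2 0 _ (hpos R)
    -- The interpolation lemma is applied to `-f`, whose derivative `-f'` is again completely
    -- monotone; the induction hypothesis covers it on proper subsets.
    · have h := hg.altSum_comp_nonpos_of_deriv (f := fun t => -f t)
        (fun t ht => (hf.hasDerivAt ht).neg) (Finset.notMem_erase i A)
        (fun k hk hk' B hB R =>
          ih B (hB.trans_ssubset (Finset.erase_ssubset hi)) hf.neg_deriv hk hk' R) hpos R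
      rw [Finset.insert_erase hi, altSum_neg] at h
      linarith

theorem altSum_comp_nonneg {f : ℝ → ℝ} (hf : IsCompletelyMonotone f)
    (hf0 : ContinuousOn f (Ici 0)) {g : Finset ι → ℝ} (hg0 : ∀ S, 0 ≤ g S) (hg : IsAlternating g)
    (A R : Finset ι) : 0 ≤ altSum A R (fun S => f (g S)) := by
  -- Derivatives are controlled only on `(0, ∞)`: shift `g` by `ε > 0`, which keeps it alternating,
  -- and let `ε` tend to `0`.
  refine ge_of_tendsto (IsAlternating.tendsto_altSum_comp_add hf0 hg0 A R) ?_
  filter_upwards [self_mem_nhdsWithin] with ε hε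
  exact altSum_comp_nonneg_of_pos A hf (fun S => add_pos_of_nonneg_of_pos (hg0 S) hε)
    (hg.add (IsAlternating.const ε)) R

end IsCompletelyMonotone

/-- One interpolation step suffices, since `h'` is completely monotone. No sign of `h` is needed,
because only nonempty `A` occur. -/
theorem IsAlternating.comp_of_deriv {h : ℝ → ℝ} (hd : DifferentiableOn ℝ h (Ioi 0))
    (hcm : IsCompletelyMonotone (deriv h)) (hc : ContinuousOn h (Ici 0)) {g : Finset ι → ℝ}
    (hg0 : ∀ S, 0 ≤ g S) (hg : IsAlternating g) : IsAlternating (fun S => h (g S)) := by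
  rintro A R ⟨i, hi⟩
  refine le_of_tendsto (IsAlternating.tendsto_altSum_comp_add hc hg0 A R) ?_
  filter_upwards [self_mem_nhdsWithin] with ε hε
  rw [← Finset.insert_erase hi]
  exact (hg.add (IsAlternating.const ε)).altSum_comp_nonpos_of_deriv
    (fun t ht => ((hd t ht).differentiableAt (Ioi_mem_nhds ht)).hasDerivAt)
    (Finset.notMem_erase i A)
    (fun k hk hk' B _ R => hcm.altSum_comp_nonneg_of_pos B hk hk' R)
    (fun S => add_pos_of_nonneg_of_pos (hg0 S) hε) R

end AltSum

/-! Completely monotone generators -/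

namespace IsCMGenerator

variable {ψ : ℝ≥0∞ → ℝ}

theorem continuous_comp_ofReal (h : IsCMGenerator ψ) :
    Continuous (fun t : ℝ => ψ (ENNReal.ofReal t)) :=
  h.1.continuous.comp ENNReal.continuous_ofReal

/-- Take the alternating sum of `ψ (|S| r / 2)` over a set of `k + 1` points. Terms with `|S| ≥ 2`
vanish, which leaves `1 - (k + 1) ψ (r / 2) ≥ 0`. -/
theorem mul_le_one_of_map_eq_zero (h : IsCMGenerator ψ) {r : ℝ} (hr : 0 ≤ r)
    (h0 : ψ (ENNReal.ofReal r) = 0) (k : ℕ) : k * ψ (ENNReal.ofReal (r / 2)) ≤ 1 := by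
  have halt : IsAlternating (fun S : Finset (Fin (k + 1)) => (S.card : ℝ) * (r / 2)) := by
    have : (fun S : Finset (Fin (k + 1)) => (S.card : ℝ) * (r / 2)) =
        fun S => ∑ i, if i ∈ S then r / 2 else 0 := by
      funext S; simp
    rw [this]
    exact IsAlternating.sum fun i _ => IsAlternating.ite_mem i (by positivity)
  have hsum := h.2.altSum_comp_nonneg h.continuous_comp_ofReal.continuousOn
    (fun S => by positivity) halt Finset.univ ∅
  simp only [altSum, Finset.union_empty] at hsum
  rw [Finset.sum_powerset_apply_card
    (fun m : ℕ => (-1 : ℝ) ^ m * ψ (ENNReal.ofReal ((m : ℝ) * (r / 2)))), Finset.card_fin,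
    Finset.sum_range_succ', Finset.sum_range_succ', Finset.sum_eq_zero] at hsum
  · have hpos := (h.1.mem_unit (ENNReal.ofReal (r / 2))).1
    simp [h.1.map_zero] at hsum
    linarith
  · intro m _
    have hle : r ≤ ((m + 1 + 1 : ℕ) : ℝ) * (r / 2) := by
      push_cast
      nlinarith [mul_nonneg (Nat.cast_nonneg (α := ℝ) m) hr]
    have : ψ (ENNReal.ofReal (((m + 1 + 1 : ℕ) : ℝ) * (r / 2))) = 0 :=
      le_antisymm (h0 ▸ h.1.antitone (ENNReal.ofReal_le_ofReal hle)) (h.1.mem_unit _).1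
    rw [this, mul_zero, smul_zero]

/-- At a least finite zero `m`, the preceding bound for all `k` would force `ψ (m / 2) = 0`, against
minimality. Consequently `ψ` is strictly decreasing on all of `[0, ∞]` and `genInv` is a genuine
inverse on `[0, 1]`. -/
theorem pos (h : IsCMGenerator ψ) {t : ℝ≥0∞} (ht : t ≠ ⊤) : 0 < ψ t := by
  refine (h.1.mem_unit t).1.lt_of_ne' fun hzero => ?_
  have hmem : sInf {t | ψ t = 0} ∈ {t | ψ t = 0} :=
    (isClosed_singleton.preimage h.1.continuous).csInf_mem ⟨t, hzero⟩ (OrderBot.bddBelow _)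
  set m := sInf {t | ψ t = 0} with hm
  have hmtop : m ≠ ⊤ := ne_top_of_le_ne_top ht (sInf_le hzero)
  have hm0 : m ≠ 0 := fun h0 => by
    rw [h0, mem_ofPred_eq, h.1.map_zero] at hmem
    exact one_ne_zero hmem
  have hr : 0 < m.toReal := ENNReal.toReal_pos hm0 hmtop
  have hle := h.mul_le_one_of_map_eq_zero hr.le (by rw [ENNReal.ofReal_toReal hmtop]; exact hmem)
  have hhalf : 0 < ψ (ENNReal.ofReal (m.toReal / 2)) := by
    refine (h.1.mem_unit _).1.lt_of_ne' fun h0 => ?_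
    have h1 : m ≤ ENNReal.ofReal (m.toReal / 2) := sInf_le h0
    rw [← ENNReal.ofReal_toReal hmtop, ENNReal.toReal_ofReal hr.le,
      ENNReal.ofReal_le_ofReal_iff (by positivity)] at h1
    linarith
  obtain ⟨k, hk⟩ := exists_nat_gt (1 / ψ (ENNReal.ofReal (m.toReal / 2)))
  rw [div_lt_iff₀ hhalf] at hk
  exact absurd (hle k) (not_le.2 hk)

theorem strictAnti (h : IsCMGenerator ψ) : StrictAnti ψ := by
  have htop : sInf {t | ψ t = 0} = ⊤ := by
    refine sInf_eq_top.2 fun t ht => ?_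
    by_contra hne
    exact (h.pos hne).ne' ht
  have hs := h.1.strictAntiOn
  rw [htop] at hs
  exact fun s t hst => hs ⟨zero_le, le_top⟩ ⟨zero_le, le_top⟩ hst

theorem genInv_apply (h : IsCMGenerator ψ) (t : ℝ≥0∞) : genInv ψ (ψ t) = t := by
  have : {s | ψ s = ψ t} = {t} := by
    ext s
    simp [h.strictAnti.injective.eq_iff]
  rw [genInv, this, sInf_singleton]

theorem exists_apply_eq (h : IsCMGenerator ψ) {s : ℝ} (hs : s ∈ Icc (0 : ℝ) 1) :
    ∃ t, ψ t = s :=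
  mem_range_of_exists_le_of_exists_ge h.1.continuous ⟨⊤, h.1.map_top ▸ hs.1⟩
    ⟨0, h.1.map_zero ▸ hs.2⟩

theorem apply_genInv (h : IsCMGenerator ψ) {s : ℝ} (hs : s ∈ Icc (0 : ℝ) 1) :
    ψ (genInv ψ s) = s := by
  obtain ⟨t, rfl⟩ := h.exists_apply_eq hs
  rw [h.genInv_apply]

theorem genInv_one (h : IsCMGenerator ψ) : genInv ψ 1 = 0 := by
  rw [← h.1.map_zero, h.genInv_apply]

theorem genInv_zero (h : IsCMGenerator ψ) : genInv ψ 0 = ⊤ := by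
  rw [← h.1.map_top, h.genInv_apply]

theorem genInv_le_genInv (h : IsCMGenerator ψ) {s t : ℝ} (hs : s ∈ Icc (0 : ℝ) 1)
    (ht : t ∈ Icc (0 : ℝ) 1) (hst : s ≤ t) : genInv ψ t ≤ genInv ψ s := by
  rwa [← h.strictAnti.le_iff_ge, h.apply_genInv hs, h.apply_genInv ht]

theorem genInv_ne_top (h : IsCMGenerator ψ) {s : ℝ} (hs : s ∈ Icc (0 : ℝ) 1) (h0 : s ≠ 0) :
    genInv ψ s ≠ ⊤ := fun htop => by
  rw [← h.apply_genInv hs, htop, h.1.map_top] at h0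
  exact h0 rfl

theorem continuous_genInv_comp (h : IsCMGenerator ψ) {X : Type*} [TopologicalSpace X]
    {f : X → ℝ} (hf : Continuous f) (hmem : ∀ x, f x ∈ Icc (0 : ℝ) 1) :
    Continuous (fun x => genInv ψ (f x)) := by
  -- As `[0, ∞]` is compact, the injective continuous `ψ` is an embedding, so continuity may be
  -- tested after applying `ψ`.
  rw [(h.1.continuous.isClosedEmbedding h.strictAnti.injective).isInducing.continuous_iff]
  exact hf.congr fun x => (h.apply_genInv (hmem x)).symm

end IsCMGenerator

theorem SufficientNesting.genInv_ne_top {ψ₁ ψ₂ : ℝ≥0∞ → ℝ} (h : SufficientNesting ψ₁ ψ₂) (t : ℝ) :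
    genInv ψ₁ (ψ₂ (ENNReal.ofReal t)) ≠ ⊤ :=
  h.1.genInv_ne_top (h.2.1.1.mem_unit _) (h.2.1.pos ENNReal.ofReal_ne_top).ne'

theorem SufficientNesting.isAlternating_comp {ψ₁ ψ₂ : ℝ≥0∞ → ℝ} (h : SufficientNesting ψ₁ ψ₂)
    {ι : Type*} [DecidableEq ι] {g : Finset ι → ℝ} (hg0 : ∀ S, 0 ≤ g S) (hg : IsAlternating g) :
    IsAlternating (fun S => (genInv ψ₁ (ψ₂ (ENNReal.ofReal (g S)))).toReal) := by
  refine IsAlternating.comp_of_deriv h.2.2.1 h.2.2.2 (Continuous.continuousOn ?_) hg0 hg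
  have hc := h.1.continuous_genInv_comp h.2.1.continuous_comp_ofReal fun t => h.2.1.1.mem_unit _
  exact continuous_iff_continuousAt.2 fun t =>
    (ENNReal.tendsto_toReal (h.genInv_ne_top t)).comp hc.continuousAt

/-! Hierarchical Archimedean copulas -/

/-- The value at the node `v`, for a tree whose nodes are larger than their children. -/
noncomputable def nodeValue (d : ℕ) (children : ℕ → Finset ℕ) (lab : ℕ → ℝ≥0∞ → ℝ)
    (u : Fin d → ℝ) (v : ℕ) : ℝ :=
  if h : v < d then u ⟨v, h⟩
  else lab v (∑ w ∈ children v, if _hw : w < v then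
    genInv (lab v) (nodeValue d children lab u w) else 0)
termination_by v

namespace IsHACStructure

variable {d k : ℕ} {children : ℕ → Finset ℕ} {lab : ℕ → ℝ≥0∞ → ℝ}

theorem le_of_mem_children (h : IsHACStructure d k children) {v w : ℕ} (hw : w ∈ children v) :
    d ≤ v := by
  by_contra hv
  rw [h.leaf v (not_le.1 hv)] at hw
  exact Finset.notMem_empty w hw

theorem parent_unique (h : IsHACStructure d k children) {v v' w : ℕ} (hv : v < d + k)
    (hv' : v' < d + k) (hw : w ∈ children v) (hw' : w ∈ children v') : v = v' := by
  have hlt := h.child_lt v hv w hw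
  have hne : w ≠ d + k - 1 := fun he => h.root v hv (he ▸ hw)
  exact (h.parent w (by omega)).unique ⟨hv, hw⟩ ⟨hv', hw'⟩

/-- `IsDescendant d k children v w`: the node `w` lies in the subtree rooted in `v`. -/
def IsDescendant (d k : ℕ) (children : ℕ → Finset ℕ) : ℕ → ℕ → Prop :=
  Relation.ReflTransGen (fun v w => v < d + k ∧ w ∈ children v)

theorem isDescendant_root (h : IsHACStructure d k children) {w : ℕ} (hw : w < d + k) :
    IsDescendant d k children (d + k - 1) w := by
  have hmem := h.reachable w hw
  have hpos : 0 < d + k := by omega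
  suffices IsDescendant d k children (d + k - 1) w ∧ w < d + k from this.1
  clear hw
  induction hmem with
  | refl => exact ⟨.refl, by omega⟩
  | tail _ hstep ih => exact ⟨ih.1.tail ⟨ih.2, hstep⟩, h.child_lt _ ih.2 _ hstep⟩

theorem isDescendant_le (hlt : ∀ v < d + k, ∀ w ∈ children v, w < v) {v w : ℕ}
    (hvw : IsDescendant d k children v w) : w ≤ v := by
  induction hvw with
  | refl => exact le_rfl
  | tail _ hstep ih => exact (hlt _ hstep.1 _ hstep.2).le.trans ih

/-- Parents are unique, so the ancestors of `i` form a chain. If one child of `v` lay strictly below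
another, its parent `v` would lie weakly below that other child, against `w < v` for children. -/
theorem child_eq_of_isDescendant (h : IsHACStructure d k children)
    (hlt : ∀ v < d + k, ∀ w ∈ children v, w < v) {v w w' i : ℕ} (hv : v < d + k)
    (hw : w ∈ children v) (hw' : w' ∈ children v) (hwi : IsDescendant d k children w i)
    (hwi' : IsDescendant d k children w' i) : w = w' := by
  have huniq : Relator.RightUnique (Function.swap fun v w => v < d + k ∧ w ∈ children v) :=
    fun c p p' hp hp' => h.parent_unique hp.1 hp'.1 hp.2 hp'.2
  have key : ∀ {x y : ℕ}, x ∈ children v → y ∈ children v → IsDescendant d k children x y →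
      y = x := fun {x y} hx hy hxy => by
    rcases Relation.ReflTransGen.cases_tail hxy with he | ⟨p, hp, hpy⟩
    · exact he
    · have : p = v := h.parent_unique hpy.1 hv hpy.2 hy
      have h1 := isDescendant_le hlt hp
      have h2 := hlt v hv x hx
      omega
  rcases Relation.ReflTransGen.total_of_right_unique huniq hwi.swap hwi'.swap with hr | hr
  · exact key hw' hw hr.swap
  · exact (key hw hw' hr.swap).symm

theorem nodeValue_leaf (u : Fin d → ℝ) (i : Fin d) : nodeValue d children lab u i = u i := by
  rw [nodeValue, dif_pos i.2]

theorem nodeValue_fork (hlt : ∀ v < d + k, ∀ w ∈ children v, w < v) (u : Fin d → ℝ) {v : ℕ}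
    (hdv : d ≤ v) (hv : v < d + k) :
    nodeValue d children lab u v =
      archValue (lab v) (children v) (nodeValue d children lab u) := by
  rw [nodeValue, dif_neg (not_lt.2 hdv), archValue]
  -- The guard `w < v` of the recursion holds for every child, so its default value `0` is never
  -- used.
  exact congrArg _ (Finset.sum_congr rfl fun w hw => dif_pos (hlt v hv w hw))

theorem nodeValue_mem (hlt : ∀ v < d + k, ∀ w ∈ children v, w < v)
    (hlab : ∀ v, d ≤ v → v < d + k → IsCMGenerator (lab v)) {u : Fin d → ℝ}
    (hu : u ∈ Icc (0 : Fin d → ℝ) 1) {v : ℕ} (hv : v < d + k) :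
    nodeValue d children lab u v ∈ Icc (0 : ℝ) 1 := by
  by_cases hdv : v < d
  · rw [nodeValue_leaf u ⟨v, hdv⟩]
    exact ⟨hu.1 _, hu.2 _⟩
  · rw [nodeValue_fork hlt u (not_lt.1 hdv) hv]
    exact (hlab v (not_lt.1 hdv) hv).1.mem_unit _

theorem isHACFunction_nodeValue (h : IsHACStructure d k children) (hk : 0 < k)
    (hlt : ∀ v < d + k, ∀ w ∈ children v, w < v)
    (hlab : ∀ v, d ≤ v → v < d + k → IsCMGenerator (lab v)) :
    IsHACFunction d k children lab (fun u => nodeValue d children lab u (d + k - 1)) where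
  tree := h
  label := hlab
  exists_values u hu := ⟨nodeValue d children lab u, fun _ hv => nodeValue_mem hlt hlab hu hv,
    fun _ hdv hv => nodeValue_fork hlt u hdv hv, fun i => nodeValue_leaf u i⟩
  eq_root u _ x hx := by
    suffices ∀ v < d + k, nodeValue d children lab u v = x v from this _ (by omega)
    intro v
    induction v using Nat.strong_induction_on with
    | _ v ih =>
      intro hv
      by_cases hdv : v < d
      · rw [nodeValue_leaf u ⟨v, hdv⟩]
        exact (hx.leaf ⟨v, hdv⟩).symm
      · rw [nodeValue_fork hlt u (not_lt.1 hdv) hv, hx.fork v (not_lt.1 hdv) hv, archValue,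
          archValue]
        exact congrArg _ (Finset.sum_congr rfl fun w hw => by
          rw [ih w (hlt v hv w hw) (h.child_lt v hv w hw)])

/-- A zero propagates to all ancestors: `ψ⁻(0) = ∞` makes the sum infinite, and `ψ(∞) = 0`. -/
theorem nodeValue_eq_zero (h : IsHACStructure d k children)
    (hlt : ∀ v < d + k, ∀ w ∈ children v, w < v)
    (hlab : ∀ v, d ≤ v → v < d + k → IsCMGenerator (lab v)) {u : Fin d → ℝ} {i : Fin d}
    (hi : u i = 0) {v : ℕ} (hvi : IsDescendant d k children v i) :
    nodeValue d children lab u v = 0 := by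
  refine Relation.ReflTransGen.head_induction_on hvi ?_ ?_
  · rw [nodeValue_leaf, hi]
  · intro p w hpw _ ih
    have hdp := h.le_of_mem_children hpw.2
    have hgen := hlab p hdp hpw.1
    rw [nodeValue_fork hlt u hdp hpw.1, archValue,
      ENNReal.sum_eq_top.2 ⟨w, hpw.2, by rw [ih, hgen.genInv_zero]⟩, hgen.1.map_top]

open Classical in
-- Children with value `1` contribute `ψ⁻(1) = 0`, and at most one child has `i` below it, so each
-- generator on the path cancels its own inverse.
theorem nodeValue_eq_ite (h : IsHACStructure d k children)
    (hlt : ∀ v < d + k, ∀ w ∈ children v, w < v)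
    (hlab : ∀ v, d ≤ v → v < d + k → IsCMGenerator (lab v)) {u : Fin d → ℝ}
    (hu : u ∈ Icc (0 : Fin d → ℝ) 1) {i : Fin d} (hi : ∀ j, j ≠ i → u j = 1) (v : ℕ)
    (hv : v < d + k) :
    nodeValue d children lab u v = if IsDescendant d k children v i then u i else 1 := by
  induction v using Nat.strong_induction_on with
  | _ v ih =>
    by_cases hdv : v < d
    · rw [nodeValue_leaf u ⟨v, hdv⟩]
      by_cases hvi : v = i
      · subst hvi
        exact (if_pos Relation.ReflTransGen.refl).symm
      · rw [if_neg, hi _ fun he => hvi (congrArg Fin.val he)]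
        intro hdesc
        rcases Relation.ReflTransGen.cases_head hdesc with he | ⟨w, hw, _⟩
        · exact hvi he
        · exact absurd (h.le_of_mem_children hw.2) (not_le.2 hdv)
    · have hdv := not_lt.1 hdv
      have hgen := hlab v hdv hv
      have ih' : ∀ w ∈ children v, nodeValue d children lab u w =
          if IsDescendant d k children w i then u i else 1 :=
        fun w hw => ih w (hlt v hv w hw) (h.child_lt v hv w hw)
      rw [nodeValue_fork hlt u hdv hv, archValue]
      split_ifs with hdesc
      · rcases Relation.ReflTransGen.cases_head hdesc with he | ⟨w, hw, hwi⟩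
        · exact absurd i.2 (not_lt.2 (he ▸ hdv))
        · change IsDescendant d k children w i at hwi
          rw [Finset.sum_eq_single w, ih' w hw.2, if_pos hwi, hgen.apply_genInv ⟨hu.1 i, hu.2 i⟩]
          · intro w' hw' hne
            rw [ih' w' hw', if_neg, hgen.genInv_one]
            exact fun hwi' => hne (h.child_eq_of_isDescendant hlt hv hw' hw.2 hwi' hwi)
          · exact fun hnot => absurd hw.2 hnot
      · rw [Finset.sum_eq_zero, hgen.1.map_zero]
        intro w hw
        have hwi : ¬IsDescendant d k children w i :=
          fun hwi => hdesc (Relation.ReflTransGen.head ⟨hv, hw⟩ hwi)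
        rw [ih' w hw, if_neg hwi, hgen.genInv_one]

/-- Along the vertices of a box in `(0,1]^d`, every fork value is its generator at a completely
alternating set function. -/
theorem exists_isAlternating (hlt : ∀ v < d + k, ∀ w ∈ children v, w < v)
    (hlab : ∀ v, d ≤ v → v < d + k → IsCMGenerator (lab v))
    (hnest : ∀ v, d ≤ v → v < d + k → ∀ w ∈ children v, d ≤ w →
      SufficientNesting (lab v) (lab w))
    {a b : Fin d → ℝ} (ha : ∀ i, 0 < a i) (hab : a ≤ b) (hb : b ≤ 1) (v : ℕ) (hdv : d ≤ v)
    (hv : v < d + k) :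
    ∃ g : Finset (Fin d) → ℝ, (∀ S, 0 ≤ g S) ∧ IsAlternating g ∧ ∀ S,
      nodeValue d children lab (fun i => if i ∈ S then a i else b i) v =
        lab v (ENNReal.ofReal (g S)) := by
  induction v using Nat.strong_induction_on with
  | _ v ih =>
    have hgen := hlab v hdv hv
    set x : Finset (Fin d) → ℕ → ℝ :=
      fun S => nodeValue d children lab (fun i => if i ∈ S then a i else b i) with hx
    -- Finiteness, which uses that the box avoids zero coordinates, lets the sum of inverses be
    -- taken in `ℝ` without loss.
    have hchild : ∀ w ∈ children v, (∀ S, genInv (lab v) (x S w) ≠ ⊤) ∧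
        IsAlternating (fun S => (genInv (lab v) (x S w)).toReal) := fun w hw => by
      by_cases hdw : w < d
      · have hmema : a ⟨w, hdw⟩ ∈ Icc (0 : ℝ) 1 := ⟨(ha _).le, (hab _).trans (hb _)⟩
        have hmemb : b ⟨w, hdw⟩ ∈ Icc (0 : ℝ) 1 := ⟨(ha _).le.trans (hab _), hb _⟩
        have hta := hgen.genInv_ne_top hmema (ha _).ne'
        have htb := hgen.genInv_ne_top hmemb ((ha _).trans_le (hab _)).ne'
        have hval : ∀ S, genInv (lab v) (x S w) = if (⟨w, hdw⟩ : Fin d) ∈ S then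
            genInv (lab v) (a ⟨w, hdw⟩) else genInv (lab v) (b ⟨w, hdw⟩) := fun S => by
          rw [hx, ← apply_ite (genInv (lab v))]
          exact congrArg _ (nodeValue_leaf _ ⟨w, hdw⟩)
        refine ⟨fun S => ?_, ?_⟩
        · rw [hval]
          split_ifs <;> assumption
        · simp only [hval, apply_ite ENNReal.toReal]
          exact IsAlternating.ite_mem _
            (ENNReal.toReal_mono hta (hgen.genInv_le_genInv hmema hmemb (hab _)))
      · obtain ⟨g, hg0, hg, hgx⟩ :=
          ih w (hlt v hv w hw) (not_lt.1 hdw) ((hlt v hv w hw).trans hv)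
        have hn := hnest v hdv hv w hw (not_lt.1 hdw)
        have hgx' : ∀ S, x S w = lab w (ENNReal.ofReal (g S)) := hgx
        simp only [hgx']
        exact ⟨fun S => hn.genInv_ne_top _, hn.isAlternating_comp hg0 hg⟩
    refine ⟨fun S => ∑ w ∈ children v, (genInv (lab v) (x S w)).toReal,
      fun S => Finset.sum_nonneg fun w _ => ENNReal.toReal_nonneg,
      IsAlternating.sum fun w hw => (hchild w hw).2, fun S => ?_⟩
    rw [nodeValue_fork hlt _ hdv hv, archValue,
      ENNReal.ofReal_sum_of_nonneg fun w _ => ENNReal.toReal_nonneg]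
    exact congrArg _ (Finset.sum_congr rfl fun w hw =>
      (ENNReal.ofReal_toReal ((hchild w hw).1 S)).symm)

/-- A hierarchical Archimedean function that satisfies the sufficient nesting condition is a
copula. -/
theorem isCopula_nodeValue (h : IsHACStructure d k children) (hk : 0 < k)
    (hlt : ∀ v < d + k, ∀ w ∈ children v, w < v)
    (hlab : ∀ v, d ≤ v → v < d + k → IsCMGenerator (lab v))
    (hnest : ∀ v, d ≤ v → v < d + k → ∀ w ∈ children v, d ≤ w →
      SufficientNesting (lab v) (lab w)) :
    IsCopula (fun u => nodeValue d children lab u (d + k - 1)) where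
  grounded := fun u _ ⟨i, hi⟩ =>
    h.nodeValue_eq_zero hlt hlab hi (h.isDescendant_root (i.2.trans_le (Nat.le_add_right d k)))
  margins u hu i hi := by
    rw [h.nodeValue_eq_ite hlt hlab hu hi _ (by omega),
      if_pos (h.isDescendant_root (i.2.trans_le (Nat.le_add_right d k)))]
  increasing a ha b hb hab := by
    have hground : ∀ (u : Fin d → ℝ) (i : Fin d), u i = 0 →
        nodeValue d children lab u (d + k - 1) = 0 := fun u i hi =>
      h.nodeValue_eq_zero hlt hlab hi (h.isDescendant_root (i.2.trans_le (Nat.le_add_right d k)))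
    by_cases hb0 : ∃ i, b i = 0
    · obtain ⟨i, hi⟩ := hb0
      have hai : a i = 0 := le_antisymm (hi ▸ hab i) (ha.1 i)
      refine (Finset.sum_eq_zero fun S _ => ?_).ge
      rw [hground _ i (by simp [hi, hai]), mul_zero]
    · push Not at hb0
      have hbpos : ∀ i, 0 < b i := fun i => (hb.1 i).lt_of_ne' (hb0 i)
      -- Zero coordinates of `a` are moved to those of `b` to make the box positive. Vertices that
      -- use a zero coordinate have value `0`, so the volume is an alternating sum over the
      -- coordinates with `a i ≠ 0` only.
      set a' : Fin d → ℝ := fun i => if a i = 0 then b i else a i with ha'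
      have ha'pos : ∀ i, 0 < a' i := fun i => by
        simp only [ha']
        split_ifs with hi
        · exact hbpos i
        · exact (ha.1 i).lt_of_ne' hi
      have ha'b : a' ≤ b := fun i => by
        simp only [ha']
        split_ifs
        · exact le_rfl
        · exact hab i
      obtain ⟨g, hg0, hg, hgx⟩ := exists_isAlternating hlt hlab hnest ha'pos ha'b hb.2
        (d + k - 1) (by omega) (by omega)
      have hgen := hlab (d + k - 1) (by omega) (by omega)
      have hnn := hgen.2.altSum_comp_nonneg hgen.continuous_comp_ofReal.continuousOn hg0 hg
        (Finset.univ.filter fun i => a i ≠ 0) ∅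
      refine hnn.trans_eq ?_
      rw [altSum]
      refine Eq.trans (Finset.sum_congr rfl fun S hS => ?_)
        (Finset.sum_subset (Finset.subset_univ _) fun S _ hS => ?_)
      · rw [Finset.union_empty, ← hgx]
        congr 2
        funext i
        split_ifs with hi
        · have := (Finset.mem_filter.1 (Finset.mem_powerset.1 hS hi)).2
          simp [ha', this]
        · rfl
      · rw [Finset.mem_powerset, Finset.not_subset] at hS
        obtain ⟨i, hiS, hi⟩ := hS
        have hi0 : a i = 0 := by simpa using hi
        rw [hground _ i (by simp [hiS, hi0]), mul_zero]

end IsHACStructure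

/-! Structure estimation -/

section BlockAvg

variable {d : ℕ} {T : Matrix (Fin d) (Fin d) ℝ}

theorem blockAvg_comm (hT : T.IsSymm) (A B : Finset (Fin d)) :
    blockAvg T A B = blockAvg T B A := by
  rw [blockAvg, blockAvg, Finset.card_product, Finset.card_product, mul_comm A.card,
    Finset.sum_product, Finset.sum_product_right]
  congr 1
  exact Finset.sum_congr rfl fun p _ => Finset.sum_congr rfl fun q _ => hT.apply q p

theorem blockAvg_le_iff {A B : Finset (Fin d)} (hA : A.Nonempty) (hB : B.Nonempty) {c : ℝ} :
    blockAvg T A B ≤ c ↔ ∑ p ∈ A ×ˢ B, T p.1 p.2 ≤ c * ((A ×ˢ B).card : ℝ) :=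
  div_le_iff₀ (Nat.cast_pos.2 (hA.product hB).card_pos)

theorem blockAvg_union_le {A A' B : Finset (Fin d)} (hdisj : Disjoint A A') (hA : A.Nonempty)
    (hA' : A'.Nonempty) (hB : B.Nonempty) {c : ℝ} (h : blockAvg T A B ≤ c)
    (h' : blockAvg T A' B ≤ c) : blockAvg T (A ∪ A') B ≤ c := by
  rw [blockAvg_le_iff hA hB] at h
  rw [blockAvg_le_iff hA' hB] at h'
  have hd : Disjoint (A ×ˢ B) (A' ×ˢ B) := Finset.disjoint_product.2 (Or.inl hdisj)
  rw [blockAvg_le_iff (hA.mono Finset.subset_union_left) hB, Finset.union_product,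
    Finset.sum_union hd, Finset.card_union_of_disjoint hd]
  push_cast
  linarith

end BlockAvg

/-- The invariants of the structure estimation algorithm after `k` passes of its loop. -/
structure ClusterState.IsForest {d : ℕ} (T : Matrix (Fin d) (Fin d) ℝ) (k : ℕ)
    (s : ClusterState d) : Prop where
  active_lt : ∀ v ∈ s.active, v < d + k
  card_active : s.active.card + k = d
  nonempty : ∀ v ∈ s.active, (s.leaves v).Nonempty
  disjoint : ∀ v ∈ s.active, ∀ w ∈ s.active, v ≠ w → Disjoint (s.leaves v) (s.leaves w)
  leaf : ∀ v < d, s.children v = ∅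
  fork : ∀ v, d ≤ v → v < d + k → ∃ i j, i < j ∧ j < v ∧ s.children v = {i, j}
  parent : ∀ w < d + k, w ∉ s.active → ∃! v, v < d + k ∧ w ∈ s.children v
  notMem_children : ∀ w ∈ s.active, ∀ v < d + k, w ∉ s.children v
  avg_le : ∀ f, d ≤ f → f < d + k → ∀ v ∈ s.active, ∀ w ∈ s.active, v ≠ w →
    blockAvg T (s.leaves v) (s.leaves w) ≤ s.tauHat f
  tauHat_le : ∀ f g, d ≤ f → f ≤ g → g < d + k → s.tauHat g ≤ s.tauHat f

namespace ClusterState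

variable {d : ℕ} {T : Matrix (Fin d) (Fin d) ℝ}

theorem isForest_init : (ClusterState.init d).IsForest T 0 where
  active_lt v hv := Finset.mem_range.1 hv
  card_active := by simp [ClusterState.init]
  nonempty v hv := ⟨⟨v, Finset.mem_range.1 hv⟩, by simp [ClusterState.init]⟩
  disjoint v _ w _ hvw := by
    rw [Finset.disjoint_left]
    intro l hl hl'
    simp only [ClusterState.init, Finset.mem_filter, Finset.mem_univ, true_and] at hl hl'
    exact hvw (hl.symm.trans hl')
  leaf _ _ := rfl
  fork v h1 h2 := by omega
  parent w hw hnot := absurd (Finset.mem_range.2 hw) hnot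
  notMem_children _ _ _ _ := Finset.notMem_empty _
  avg_le f h1 h2 := by omega
  tauHat_le f g h1 h2 h3 := by omega

theorem IsArgmax.blockAvg_le {s : ClusterState d} {i j : ℕ} (hT : T.IsSymm)
    (hij : s.IsArgmax T i j) {v w : ℕ} (hv : v ∈ s.active) (hw : w ∈ s.active) (hvw : v ≠ w) :
    blockAvg T (s.leaves v) (s.leaves w) ≤ blockAvg T (s.leaves i) (s.leaves j) := by
  rcases hvw.lt_or_gt with h | h
  · exact hij.2.2.2 v hv w hw h
  · rw [blockAvg_comm hT]
    exact hij.2.2.2 w hw v hv h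

theorem IsForest.join {s : ClusterState d} {k i j : ℕ} (hT : T.IsSymm) (hs : s.IsForest T k)
    (hij : s.IsArgmax T i j) : (s.join T i j (d + k)).IsForest T (k + 1) := by
  obtain ⟨hi, hj, hlt, -⟩ := id hij
  have hid := hs.active_lt i hi
  have hjd := hs.active_lt j hj
  have hmem : ∀ v, v ∈ (s.join T i j (d + k)).active ↔
      (v = d + k ∨ v ∈ s.active) ∧ v ≠ i ∧ v ≠ j := fun v => by
    simp [ClusterState.join]
  have hch : ∀ v, v ≠ d + k → (s.join T i j (d + k)).children v = s.children v :=
    fun v hv => Function.update_of_ne hv _ _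
  have hch' : (s.join T i j (d + k)).children (d + k) = {i, j} := Function.update_self _ _ _
  have hle : ∀ v, v ≠ d + k → (s.join T i j (d + k)).leaves v = s.leaves v :=
    fun v hv => Function.update_of_ne hv _ _
  have hle' : (s.join T i j (d + k)).leaves (d + k) = s.leaves i ∪ s.leaves j :=
    Function.update_self _ _ _
  have hta : ∀ v, v ≠ d + k → (s.join T i j (d + k)).tauHat v = s.tauHat v :=
    fun v hv => Function.update_of_ne hv _ _
  have hta' : (s.join T i j (d + k)).tauHat (d + k) = blockAvg T (s.leaves i) (s.leaves j) :=
    Function.update_self _ _ _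
  have hne : ∀ v ∈ s.active, v ≠ d + k := fun v hv => (hs.active_lt v hv).ne
  have hold : ∀ v, v ∈ (s.join T i j (d + k)).active → v ≠ d + k →
      v ∈ s.active ∧ v ≠ i ∧ v ≠ j := fun v hv hvk => by
    have := (hmem v).1 hv
    exact ⟨this.1.resolve_left hvk, this.2⟩
  have hdisj : ∀ w, w ∈ (s.join T i j (d + k)).active → w ≠ d + k →
      Disjoint (s.leaves i ∪ s.leaves j) (s.leaves w) := fun w hw hwk => by
    obtain ⟨hw, hwi, hwj⟩ := hold w hw hwk
    exact Finset.disjoint_union_left.2 ⟨hs.disjoint i hi w hw hwi.symm,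
      hs.disjoint j hj w hw hwj.symm⟩
  -- The average just attained bounds all averages after the join. This makes `avg_le` inductive,
  -- and `avg_le` in turn bounds every later `tauHat`.
  have hmax : ∀ v ∈ (s.join T i j (d + k)).active, ∀ w ∈ (s.join T i j (d + k)).active, v ≠ w →
      blockAvg T ((s.join T i j (d + k)).leaves v) ((s.join T i j (d + k)).leaves w) ≤
        blockAvg T (s.leaves i) (s.leaves j) := by
    have hnew : ∀ w ∈ (s.join T i j (d + k)).active, w ≠ d + k →
        blockAvg T (s.leaves i ∪ s.leaves j) (s.leaves w) ≤
          blockAvg T (s.leaves i) (s.leaves j) := fun w hw hwk => by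
      obtain ⟨hw, hwi, hwj⟩ := hold w hw hwk
      exact blockAvg_union_le (hs.disjoint i hi j hj hlt.ne) (hs.nonempty i hi)
        (hs.nonempty j hj) (hs.nonempty w hw) (hij.blockAvg_le hT hi hw hwi.symm)
        (hij.blockAvg_le hT hj hw hwj.symm)
    intro v hv w hw hvw
    by_cases hvk : v = d + k
    · subst hvk
      rw [hle', hle w hvw.symm]
      exact hnew w hw hvw.symm
    · by_cases hwk : w = d + k
      · subst hwk
        rw [hle', hle v hvk, blockAvg_comm hT]
        exact hnew v hv hvk
      · rw [hle v hvk, hle w hwk]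
        exact hij.blockAvg_le hT (hold v hv hvk).1 (hold w hw hwk).1 hvw
  have hprev : ∀ f, d ≤ f → f < d + k →
      blockAvg T (s.leaves i) (s.leaves j) ≤ s.tauHat f :=
    fun f hf hfk => hs.avg_le f hf hfk i hi j hj hlt.ne
  have hcard := hs.card_active
  refine ⟨fun v hv => ?_, ?_, fun v hv => ?_, fun v hv w hw hvw => ?_, fun v hv => ?_,
    fun v hdv hv => ?_, fun w hw hnot => ?_, fun w hw v hv => ?_, fun f hf hfk v hv w hw hvw => ?_,
    fun f g hf hfg hg => ?_⟩
  · by_cases hvk : v = d + k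
    · omega
    · have := hs.active_lt v (hold v hv hvk).1
      omega
  · have hsub : ({i, j} : Finset ℕ) ⊆ insert (d + k) s.active := by
      intro x hx
      rcases Finset.mem_insert.1 hx with rfl | hx
      · exact Finset.mem_insert_of_mem hi
      · rw [Finset.mem_singleton.1 hx]
        exact Finset.mem_insert_of_mem hj
    have h1 : (insert (d + k) s.active).card = s.active.card + 1 :=
      Finset.card_insert_of_notMem fun h => hne _ h rfl
    have h2 := Finset.card_sdiff_add_card_eq_card hsub
    rw [Finset.card_pair hlt.ne] at h2
    simp only [ClusterState.join]
    omega
  · by_cases hvk : v = d + k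
    · rw [hvk, hle']
      exact (hs.nonempty i hi).mono Finset.subset_union_left
    · rw [hle v hvk]
      exact hs.nonempty v (hold v hv hvk).1
  · by_cases hvk : v = d + k
    · subst hvk
      rw [hle', hle w hvw.symm]
      exact hdisj w hw hvw.symm
    · by_cases hwk : w = d + k
      · subst hwk
        rw [hle', hle v hvk]
        exact (hdisj v hv hvk).symm
      · rw [hle v hvk, hle w hwk]
        exact hs.disjoint v (hold v hv hvk).1 w (hold w hw hwk).1 hvw
  · rw [hch v (by omega)]
    exact hs.leaf v hv
  · by_cases hvk : v = d + k
    · subst hvk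
      exact ⟨i, j, hlt, hjd, hch'⟩
    · rw [hch v hvk]
      exact hs.fork v hdv (by omega)
  · have hwk : w ≠ d + k := fun h => hnot ((hmem w).2 ⟨Or.inl h, by omega, by omega⟩)
    by_cases hwa : w ∈ s.active
    · have hwij : w ∈ ({i, j} : Finset ℕ) := by
        by_contra hcon
        simp only [Finset.mem_insert, Finset.mem_singleton, not_or] at hcon
        exact hnot ((hmem w).2 ⟨Or.inr hwa, hcon⟩)
      refine ⟨d + k, ⟨by omega, by rwa [hch']⟩, fun v ⟨hv, hwv⟩ => ?_⟩
      by_contra hvk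
      rw [hch v hvk] at hwv
      exact hs.notMem_children w hwa v (by omega) hwv
    · obtain ⟨p, ⟨hp, hwp⟩, huniq⟩ := hs.parent w (by omega) hwa
      refine ⟨p, ⟨by omega, by rwa [hch p hp.ne]⟩, fun v ⟨hv, hwv⟩ => ?_⟩
      by_cases hvk : v = d + k
      · rw [hvk, hch', Finset.mem_insert, Finset.mem_singleton] at hwv
        rcases hwv with rfl | rfl
        · exact absurd hi hwa
        · exact absurd hj hwa
      · rw [hch v hvk] at hwv
        exact huniq v ⟨by omega, hwv⟩
  · by_cases hvk : v = d + k
    · subst hvk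
      rw [hch', Finset.mem_insert, Finset.mem_singleton, not_or]
      exact ((hmem w).1 hw).2
    · rw [hch v hvk]
      by_cases hwk : w = d + k
      · intro hwv
        by_cases hdv : v < d
        · rw [hs.leaf v hdv] at hwv
          exact Finset.notMem_empty w hwv
        · obtain ⟨x, y, hxy, hyv, he⟩ := hs.fork v (not_lt.1 hdv) (by omega)
          rw [he, Finset.mem_insert, Finset.mem_singleton] at hwv
          omega
      · exact hs.notMem_children w (hold w hw hwk).1 v (by omega)
  · by_cases hfk' : f = d + k
    · subst hfk'
      rw [hta']
      exact hmax v hv w hw hvw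
    · rw [hta f hfk']
      exact (hmax v hv w hw hvw).trans (hprev f hf (by omega))
  · by_cases hgk : g = d + k
    · by_cases hfk : f = d + k
      · rw [hgk, hfk]
      · rw [hgk, hta', hta f hfk]
        exact hprev f hf (by omega)
    · rw [hta g hgk, hta f (by omega)]
      exact hs.tauHat_le f g hf hfg (by omega)

end ClusterState

/-! ### The output as a rooted tree -/

section Run

variable {d : ℕ} {T : Matrix (Fin d) (Fin d) ℝ}

theorem StructureRun.isForest (hT : T.IsSymm) {k : ℕ} {s : ClusterState d}
    (h : StructureRun T k s) : s.IsForest T k := by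
  induction h with
  | init => exact ClusterState.isForest_init
  | step k s i j _ hij ih => exact ih.join hT hij

namespace ClusterState.IsForest

theorem child_lt {s : ClusterState d} {k : ℕ} (hs : s.IsForest T k) {v w : ℕ}
    (hv : v < d + k) (hw : w ∈ s.children v) : w < v := by
  by_cases hdv : v < d
  · rw [hs.leaf v hdv] at hw
    exact absurd hw (Finset.notMem_empty w)
  · obtain ⟨i, j, hij, hjv, he⟩ := hs.fork v (not_lt.1 hdv) hv
    rw [he, Finset.mem_insert, Finset.mem_singleton] at hw
    omega

theorem isHACStructure {s : ClusterState d} (hd : 2 ≤ d) (hs : s.IsForest T (d - 1)) :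
    IsHACStructure d (d - 1) s.children := by
  have hcard := hs.card_active
  obtain ⟨r, hr⟩ := Finset.card_eq_one.1 (show s.active.card = 1 by omega)
  -- One active node is left. The node of largest index has no parent, since parents are larger than
  -- children, so it is that node.
  have hroot : d + (d - 1) - 1 ∈ s.active := by
    by_contra hnot
    obtain ⟨v, ⟨hv, hwv⟩, -⟩ := hs.parent _ (by omega) hnot
    have := hs.child_lt hv hwv
    omega
  have hparent : ∀ w < d + (d - 1) - 1, ∃! v, v < d + (d - 1) ∧ w ∈ s.children v := by
    refine fun w hw => hs.parent w (by omega) fun hwa => ?_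
    rw [hr, Finset.mem_singleton] at hwa hroot
    omega
  refine ⟨fun v hv w hw => (hs.child_lt hv hw).trans hv, hs.leaf, fun v hdv hv => ?_,
    fun v hv => hs.notMem_children _ hroot v hv, hparent, fun w hw => ?_⟩
  · obtain ⟨i, j, hij, -, he⟩ := hs.fork v hdv hv
    rw [he, Finset.card_pair hij.ne]
  -- Reachability goes by induction on the distance of the index from the top: the parent has a
  -- larger index.
  · induction hn : d + (d - 1) - w using Nat.strong_induction_on generalizing w with
    | _ n ih =>
      by_cases hwr : w = d + (d - 1) - 1
      · rw [hwr]
      · obtain ⟨v, ⟨hv, hwv⟩, -⟩ := hparent w (by omega)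
        have := hs.child_lt hv hwv
        exact (ih _ (by omega) v hv rfl).tail hwv

end ClusterState.IsForest

end Run

/-! ### Ordered parameters and the copula property -/

theorem mainTheorem4 (F : ArchFamily) (τa : ℝ → ℝ)
    (h_tau : ∀ θ ∈ F.Θ, τa θ = kendallTau (archCopula 2 (F.gen θ)))
    (h_mono : StrictMonoOn τa F.Θ)
    (h_nest : ∀ θ₁ ∈ F.Θ, ∀ θ₂ ∈ F.Θ,
      SufficientNesting (F.gen θ₁) (F.gen θ₂) ↔ θ₁ ≤ θ₂)
    (d : ℕ) (hd : 2 ≤ d) (T : Matrix (Fin d) (Fin d) ℝ) (hT : T.IsSymm)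
    (est : ClusterState d) (h_est : IsStructureEstimate T est)
    (h_range : ∀ v, d ≤ v → v < d + (d - 1) → est.tauHat v ∈ τa '' F.Θ) :
    (∀ v, d ≤ v → v < d + (d - 1) → ∀ w ∈ est.children v, d ≤ w → w < d + (d - 1) →
      thetaHat F τa est.tauHat v ≤ thetaHat F τa est.tauHat w) ∧
    ∃ C : (Fin d → ℝ) → ℝ,
      IsHACFunction d (d - 1) est.children (labelHat F τa est.tauHat) C ∧ IsCopula C := by
  have hs : est.IsForest T (d - 1) := StructureRun.isForest hT h_est
  have htree := hs.isHACStructure hd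
  have hmem : ∀ v, d ≤ v → v < d + (d - 1) → thetaHat F τa est.tauHat v ∈ F.Θ :=
    fun v hdv hv => Function.invFunOn_mem (h_range v hdv hv)
  have heq : ∀ v, d ≤ v → v < d + (d - 1) → τa (thetaHat F τa est.tauHat v) = est.tauHat v :=
    fun v hdv hv => Function.invFunOn_eq (h_range v hdv hv)
  have hlt : ∀ v < d + (d - 1), ∀ w ∈ est.children v, w < v := fun v hv w hw => hs.child_lt hv hw
  have htheta : ∀ v, d ≤ v → v < d + (d - 1) → ∀ w ∈ est.children v, d ≤ w → w < d + (d - 1) →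
      thetaHat F τa est.tauHat v ≤ thetaHat F τa est.tauHat w := fun v hdv hv w hw hdw hw' => by
    rw [← h_mono.le_iff_le (hmem v hdv hv) (hmem w hdw hw'), heq v hdv hv, heq w hdw hw']
    exact hs.tauHat_le w v hdw (hlt v hv w hw).le hv
  have hlab : ∀ v, d ≤ v → v < d + (d - 1) → IsCMGenerator (labelHat F τa est.tauHat v) :=
    fun v hdv hv => F.isCMGenerator _ (hmem v hdv hv)
  refine ⟨htheta, _, htree.isHACFunction_nodeValue (by omega) hlt hlab,
    htree.isCopula_nodeValue (by omega) hlt hlab fun v hdv hv w hw hdw => ?_⟩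
  have hw' := (hlt v hv w hw).trans hv
  exact (h_nest _ (hmem v hdv hv) _ (hmem w hdw hw')).2 (htheta v hdv hv w hw hdw hw')
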